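/- Let \(\kappa\) be a regular cardinal and let \(\mathcal A\) be a \(\kappa\)-accessible category; write \(\mathcal A_{<\kappa}\subset\mathcal A\) for the full subcategory of \(\kappa\)-presentable objects. A morphism \(p\colon D\to E\) in \(\mathcal A\) is called a \(\kappa\)-pure epimorphism if for every \(\kappa\)-presentable object \(S\) and every morphism \(e\colon S\to E\) there is a morphism \(l\colon S\to D\) with \(p\circ l=e\). A category \(\mathcal C\) is said to have very weak split pullbacks if for all morphisms \(f\colon B\to A\), \(g\colon C\to A\), \(q_B\colon Q\to B\), \(q_C\colon Q\to C\) in \(\mathcal C\) such that \(g=f\circ h\) for some \(h\colon C\to B\), and such that \(f\circ q_B=g\circ q_C\), there exist an object \(P\) and morphisms \(p_B\colon P\to B\), \(p_C\colon P\to C\) such that \(f\circ p_B=g\circ p_C\), the morphism \(p_C\) is a split epimorphism, and there is a morphism \(r\colon Q\to P\) with \(q_B=p_B\circ r\) and \(q_C=p_C\circ r\). Suppose that \(\mathcal A\) has very weak split pullbacks (for example, this holds if \(\mathcal A\) has finite coproducts). Assume further that pullbacks of split epimorphisms (along arbitrary morphisms) exist in the category \(\mathcal A_{<\kappa}\); or,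 more generally, assume only that every split epimorphism in \(\mathcal A_{<\kappa}\) has a pullback in \(\mathcal A\) along every morphism in \(\mathcal A_{<\kappa}\). Then every \(\kappa\)-pure epimorphism in \(\mathcal A\) has a pullback along every morphism in \(\mathcal A\), and all such pullbacks are \(\kappa\)-pure epimorphisms. -/

import Mathlib

open CategoryTheory CategoryTheory.Limits

universe u v w

/-- A cospan `f : B ⟶ A`, `g : C ⟶ A` is split if `g` factors through `f`. -/
def IsSplitCospan {𝒞 : Type u} [Category.{v} 𝒞] {A B C : 𝒞} (f : B ⟶ A) (g : C ⟶ A) : Prop :=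
  ∃ h : C ⟶ B, h ≫ f = g

/-- The pair of morphisms `pB : P ⟶ B`, `pC : P ⟶ C` is a very weak split pullback of the
cospan `(f, g)` with respect to the pair `(qB, qC)`. -/
structure IsVeryWeakSplitPullback {𝒞 : Type u} [Category.{v} 𝒞] {A B C Q P : 𝒞}
    (f : B ⟶ A) (g : C ⟶ A) (qB : Q ⟶ B) (qC : Q ⟶ C) (pB : P ⟶ B) (pC : P ⟶ C) : Prop where
  comm : pB ≫ f = pC ≫ g
  exists_lift : ∃ r : Q ⟶ P, r ≫ pB = qB ∧ r ≫ pC = qC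
  isSplitEpi : IsSplitEpi pC

/-- A category has very weak split pullbacks if every split cospan has a very weak split pullback
with respect to every pair of morphisms completing the cospan to a commutative square. -/
def HasVeryWeakSplitPullbacks (𝒞 : Type u) [Category.{v} 𝒞] : Prop :=
  ∀ ⦃A B C Q : 𝒞⦄ (f : B ⟶ A) (g : C ⟶ A) (qB : Q ⟶ B) (qC : Q ⟶ C),
    IsSplitCospan f g → qB ≫ f = qC ≫ g →
      ∃ (P : 𝒞) (pB : P ⟶ B) (pC : P ⟶ C), IsVeryWeakSplitPullback f g qB qC pB pC

/-- The class of split epimorphisms of a category. -/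
def splitEpimorphisms (𝒞 : Type u) [Category.{v} 𝒞] : MorphismProperty 𝒞 :=
  fun _ _ p => IsSplitEpi p

/-- The class of `κ`-pure epimorphisms: the morphisms `p : D ⟶ E` such that every morphism
`e : S ⟶ E` from a `κ`-presentable object `S` lifts along `p`. -/
def pureEpimorphisms (𝒞 : Type u) [Category.{v} 𝒞] (κ : Cardinal.{w}) [Fact κ.IsRegular] :
    MorphismProperty 𝒞 :=
  fun D E p => ∀ S : 𝒞, IsCardinalPresentable S κ → ∀ e : S ⟶ E, ∃ l : S ⟶ D, l ≫ p = e

/-! The pullback of `(p, q)` is built as a `κ`-filtered colimit of pullbacks of small cospans. The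
objects of `SplitCospanOver` are cospans in a small generator of `κ`-presentable objects, mapped to
`(p, q)` and with first leg a split epimorphism, so each has a pullback by hypothesis.

The crux is that this category is `κ`-filtered. A cospan built from components over `D`, `E`, `F`
need not have a split first leg. By purity, a map from a `κ`-presentable object to `E` lifts along
`p`, so it forms a split cospan with `p`; a very weak split pullback then repairs the first leg
(`exists_isSplitEpi_over`).

The colimit is tested against the generator (`isPullback_of_isCardinalFilteredGenerator`). A square
on `(p, q)` with vertex in the generator is an identity cospan over `(p, q)`, which gives lifts. Two
lifts of one square give parallel morphisms out of that cospan; filteredness coequalizes them, which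
gives uniqueness. -/

/-- In a category with finite coproducts, `C ⨿ Q` is a very weak split pullback. -/
theorem hasVeryWeakSplitPullbacks_of_hasFiniteCoproducts {𝒞 : Type u} [Category.{v} 𝒞]
    [HasFiniteCoproducts 𝒞] : HasVeryWeakSplitPullbacks 𝒞 := by
  rintro A B C Q f g qB qC ⟨h, hh⟩ hq
  refine ⟨C ⨿ Q, coprod.desc h qB, coprod.desc (𝟙 C) qC, ?_, ⟨coprod.inr, coprod.inr_desc _ _,
    coprod.inr_desc _ _⟩, ⟨⟨⟨coprod.inl, coprod.inl_desc _ _⟩⟩⟩⟩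
  ext <;> simp [hh, hq]

/-- A pullback of a `κ`-pure epimorphism is a `κ`-pure epimorphism. -/
theorem pureEpimorphisms_of_isPullback {𝒞 : Type u} [Category.{v} 𝒞] {κ : Cardinal.{w}}
    [Fact κ.IsRegular] {P D E F : 𝒞} {p : D ⟶ E} {q : F ⟶ E} {p' : P ⟶ F} {q' : P ⟶ D}
    (hp : pureEpimorphisms 𝒞 κ p) (h : IsPullback q' p' p q) : pureEpimorphisms 𝒞 κ p' := by
  intro S hS e
  obtain ⟨l, hl⟩ := hp S hS (e ≫ q)
  exact ⟨h.lift l e hl, by simp⟩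

/-! ### Factorizations through a generator of `κ`-presentable objects -/

section Generator

variable {𝒞 : Type u} [Category.{v} 𝒞] {κ : Cardinal.{w}} [Fact κ.IsRegular]
  {P : ObjectProperty 𝒞} (hP : P.IsCardinalFilteredGenerator κ)

include hP

/-- Being a pullback square can be tested on the objects of a generator. -/
theorem isPullback_of_isCardinalFilteredGenerator {W X Y Z : 𝒞} {fst : W ⟶ X} {snd : W ⟶ Y}
    {f : X ⟶ Z} {g : Y ⟶ Z} (w : fst ≫ f = snd ≫ g)
    (hex : ∀ ⦃S : 𝒞⦄, P S → ∀ (a : S ⟶ X) (b : S ⟶ Y), a ≫ f = b ≫ g →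
      ∃ l : S ⟶ W, l ≫ fst = a ∧ l ≫ snd = b)
    (huniq : ∀ ⦃S : 𝒞⦄, P S → ∀ (a b : S ⟶ W), a ≫ fst = b ≫ fst → a ≫ snd = b ≫ snd → a = b) :
    IsPullback fst snd f g := by
  have ext' : ∀ ⦃S : 𝒞⦄ (a b : S ⟶ W), a ≫ fst = b ≫ fst → a ≫ snd = b ≫ snd → a = b := by
    intro S a b h₁ h₂
    obtain ⟨J, _, _, ⟨c⟩⟩ := hP.exists_colimitsOfShape S
    refine c.isColimit.hom_ext fun j => huniq (c.prop_diag_obj j) _ _ ?_ ?_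
    · simp [h₁]
    · simp [h₂]
  have hex' : ∀ ⦃S : 𝒞⦄ (a : S ⟶ X) (b : S ⟶ Y), a ≫ f = b ≫ g →
      ∃ l : S ⟶ W, l ≫ fst = a ∧ l ≫ snd = b := by
    intro S a b hab
    obtain ⟨J, _, _, ⟨c⟩⟩ := hP.exists_colimitsOfShape S
    choose l hl₁ hl₂ using fun j => hex (c.prop_diag_obj j) (c.ι.app j ≫ a) (c.ι.app j ≫ b)
      (by simp [hab])
    -- The lifts are chosen independently for each `j`; joint monicity of `fst` and `snd` makes them
    -- compatible.
    let s : Cocone c.diag :=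
      { pt := W
        ι :=
          { app := l
            naturality := fun i j φ => by
              have hφ : c.diag.map φ ≫ c.ι.app j = c.ι.app i := by simp
              apply ext'
              · simp [hl₁, reassoc_of% hφ]
              · simp [hl₂, reassoc_of% hφ] } }
    have hs : ∀ j, c.ι.app j ≫ c.isColimit.desc s = l j := fun j => c.isColimit.fac s j
    refine ⟨c.isColimit.desc s, c.isColimit.hom_ext fun j => ?_,
      c.isColimit.hom_ext fun j => ?_⟩
    · simp [reassoc_of% (hs j), hl₁]
    · simp [reassoc_of% (hs j), hl₂]
  refine ⟨⟨w⟩, ⟨PullbackCone.IsLimit.mk w (fun s => (hex' s.fst s.snd s.condition).choose)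
    (fun s => (hex' s.fst s.snd s.condition).choose_spec.1)
    (fun s => (hex' s.fst s.snd s.condition).choose_spec.2) fun s m h₁ h₂ => ext' _ _ ?_ ?_⟩⟩
  · rw [h₁, (hex' s.fst s.snd s.condition).choose_spec.1]
  · rw [h₂, (hex' s.fst s.snd s.condition).choose_spec.2]

/-- Fewer than `κ` morphisms from `κ`-presentable objects to `X` factor through a common
morphism from an object of the generator. -/
theorem exists_common_factorization {ι : Type w} (hι : HasCardinalLT ι κ) {X : 𝒞} {S : ι → 𝒞}
    (hS : ∀ k, IsCardinalPresentable (S k) κ) (s : ∀ k, S k ⟶ X) :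
    ∃ (Y : 𝒞) (_ : P Y) (y : Y ⟶ X) (t : ∀ k, S k ⟶ Y), ∀ k, t k ≫ y = s k := by
  obtain ⟨J, _, _, ⟨c⟩⟩ := hP.exists_colimitsOfShape X
  choose j t ht using fun k => IsCardinalPresentable.exists_hom_of_isColimit κ c.isColimit (s k)
  refine ⟨_, c.prop_diag_obj (IsCardinalFiltered.max j hι), c.ι.app _,
    fun k => t k ≫ c.diag.map (IsCardinalFiltered.toMax j hι k), fun k => ?_⟩
  have := c.ι.naturality (IsCardinalFiltered.toMax j hι k)
  simp only [Functor.const_obj_obj, Functor.const_obj_map, Category.comp_id] at this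
  rw [Category.assoc, this]
  exact ht k

/-- Fewer than `κ` pairs of morphisms into a `κ`-presentable object over `X`, equal over `X`, are
simultaneously coequalized by a morphism over `X` to an object of the generator. -/
theorem exists_common_coequalization {ι : Type w} (hι : HasCardinalLT ι κ) {X Y : 𝒞} {S : ι → 𝒞}
    (hS : ∀ k, IsCardinalPresentable (S k) κ) [IsCardinalPresentable Y κ] (y : Y ⟶ X)
    (a b : ∀ k, S k ⟶ Y) (hab : ∀ k, a k ≫ y = b k ≫ y) :
    ∃ (Z : 𝒞) (_ : P Z) (z : Z ⟶ X) (t : Y ⟶ Z), t ≫ z = y ∧ ∀ k, a k ≫ t = b k ≫ t := by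
  obtain ⟨J, _, _, ⟨c⟩⟩ := hP.exists_colimitsOfShape X
  obtain ⟨j, t, ht⟩ := IsCardinalPresentable.exists_hom_of_isColimit κ c.isColimit y
  dsimp at ht
  choose j' u hu using fun k => IsCardinalPresentable.exists_eq_of_isColimit' κ c.isColimit
    (a k ≫ t) (b k ≫ t) (by simp [ht, hab])
  obtain ⟨m, v, b', hv⟩ := IsCardinalFiltered.wideSpan u hι
  refine ⟨_, c.prop_diag_obj m, c.ι.app m, t ≫ c.diag.map b', ?_, fun k => ?_⟩
  · have := c.ι.naturality b'
    simp only [Functor.const_obj_obj, Functor.const_obj_map, Category.comp_id] at this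
    rw [Category.assoc, this]
    exact ht
  · have := hu k
    simp only [Category.assoc] at this
    rw [← hv k]
    simp only [Functor.map_comp, reassoc_of% this]

/-- A morphism over a `κ`-pure epimorphism between `κ`-presentable objects maps, with fixed
codomain, to a split epimorphism whose domain is in the generator. -/
theorem exists_isSplitEpi_over (hV : HasVeryWeakSplitPullbacks 𝒞) {D E D₀ E₀ : 𝒞} {p : D ⟶ E}
    (hp : pureEpimorphisms 𝒞 κ p) (hD₀ : IsCardinalPresentable D₀ κ)
    (hE₀ : IsCardinalPresentable E₀ κ) (p₀ : D₀ ⟶ E₀) (d : D₀ ⟶ D) (e : E₀ ⟶ E)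
    (w : d ≫ p = p₀ ≫ e) :
    ∃ (D₁ : 𝒞) (_ : P D₁) (a : D₀ ⟶ D₁) (p₁ : D₁ ⟶ E₀) (d₁ : D₁ ⟶ D),
      IsSplitEpi p₁ ∧ a ≫ p₁ = p₀ ∧ a ≫ d₁ = d ∧ d₁ ≫ p = p₁ ≫ e := by
  -- `V` itself need not be presentable. Both `r` and the section of `pC` start from presentable
  -- objects, so they factor through one stage of a colimit presentation of `V`; that stage is the
  -- new domain.
  obtain ⟨V, pB, pC, hV⟩ := hV p e d p₀ (hp E₀ hE₀ e) w
  obtain ⟨r, hr₁, hr₂⟩ := hV.exists_lift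
  obtain ⟨⟨s⟩⟩ := hV.isSplitEpi
  obtain ⟨J, _, _, ⟨c⟩⟩ := hP.exists_colimitsOfShape V
  have := isFiltered_of_isCardinalFiltered J κ
  obtain ⟨i, r', hr'⟩ := IsCardinalPresentable.exists_hom_of_isColimit κ c.isColimit r
  obtain ⟨j, s', hs'⟩ := IsCardinalPresentable.exists_hom_of_isColimit κ c.isColimit s.section_
  dsimp at hr' hs'
  have h₁ := c.ι.naturality (IsFiltered.leftToMax i j)
  have h₂ := c.ι.naturality (IsFiltered.rightToMax i j)
  simp only [Functor.const_obj_obj, Functor.const_obj_map, Category.comp_id] at h₁ h₂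
  refine ⟨_, c.prop_diag_obj (IsFiltered.max i j), r' ≫ c.diag.map (IsFiltered.leftToMax i j),
    c.ι.app _ ≫ pC, c.ι.app _ ≫ pB,
    ⟨⟨⟨s' ≫ c.diag.map (IsFiltered.rightToMax i j), ?_⟩⟩⟩, ?_, ?_, ?_⟩
  · simp [reassoc_of% h₂, reassoc_of% hs']
  · simp [reassoc_of% h₁, reassoc_of% hr', hr₂]
  · simp [reassoc_of% h₁, reassoc_of% hr', hr₁]
  · simp [hV.comm]

end Generator

/-! ### The category of split cospans over `(p, q)` -/

section SplitCospan

variable {𝒜 : Type u} [Category.{w} 𝒜] {T : Type w} (G : T → 𝒜) {D E F : 𝒜}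
  (p : D ⟶ E) (q : F ⟶ E)

/-- A cospan of objects in the family `G`, with first leg a split epimorphism, together with a
morphism to the cospan `(p, q)`. -/
structure SplitCospanOver where
  /-- the index of the domain of the first leg -/
  left : T
  /-- the index of the common codomain -/
  base : T
  /-- the index of the domain of the second leg -/
  right : T
  /-- the first leg -/
  fst : G left ⟶ G base
  /-- the second leg -/
  snd : G right ⟶ G base
  /-- the morphism to the domain of `p` -/
  toLeft : G left ⟶ D
  /-- the morphism to the common codomain of `p` and `q` -/
  toBase : G base ⟶ E
  /-- the morphism to the domain of `q` -/
  toRight : G right ⟶ F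
  w_left : toLeft ≫ p = fst ≫ toBase
  w_right : toRight ≫ q = snd ≫ toBase
  isSplitEpi : IsSplitEpi fst

namespace SplitCospanOver

variable {G p q}

/-- A morphism of cospans over `(p, q)`. -/
@[ext]
structure Hom (x y : SplitCospanOver G p q) where
  /-- the first component -/
  left : G x.left ⟶ G y.left
  /-- the component on codomains -/
  base : G x.base ⟶ G y.base
  /-- the second component -/
  right : G x.right ⟶ G y.right
  w_fst : x.fst ≫ base = left ≫ y.fst
  w_snd : x.snd ≫ base = right ≫ y.snd
  w_left : left ≫ y.toLeft = x.toLeft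
  w_base : base ≫ y.toBase = x.toBase
  w_right : right ≫ y.toRight = x.toRight

attribute [simp] Hom.w_left Hom.w_base Hom.w_right
/-- The identity morphism. -/
@[simps]
def Hom.id (x : SplitCospanOver G p q) : Hom x x where
  left := 𝟙 _
  base := 𝟙 _
  right := 𝟙 _
  w_fst := by simp
  w_snd := by simp
  w_left := by simp
  w_base := by simp
  w_right := by simp

/-- The composition of morphisms. -/
@[simps]
def Hom.comp {x y z : SplitCospanOver G p q} (f : Hom x y) (g : Hom y z) : Hom x z where
  left := f.left ≫ g.left
  base := f.base ≫ g.base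
  right := f.right ≫ g.right
  w_fst := by rw [reassoc_of% f.w_fst, g.w_fst, Category.assoc]
  w_snd := by rw [reassoc_of% f.w_snd, g.w_snd, Category.assoc]
  w_left := by simp
  w_base := by simp
  w_right := by simp

instance : Category.{w} (SplitCospanOver G p q) where
  Hom := Hom
  id := Hom.id
  comp := Hom.comp
  id_comp f := by ext <;> simp
  comp_id f := by ext <;> simp
  assoc f g h := by ext <;> simp

@[ext]
theorem hom_ext {x y : SplitCospanOver G p q} {f g : x ⟶ y} (h₁ : f.left = g.left)
    (h₂ : f.base = g.base) (h₃ : f.right = g.right) : f = g :=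
  Hom.ext h₁ h₂ h₃

@[simp]
theorem id_left (x : SplitCospanOver G p q) : Hom.left (𝟙 x) = 𝟙 _ := rfl

@[simp]
theorem id_right (x : SplitCospanOver G p q) : Hom.right (𝟙 x) = 𝟙 _ := rfl

@[simp]
theorem comp_left {x y z : SplitCospanOver G p q} (f : x ⟶ y) (g : y ⟶ z) :
    (f ≫ g).left = f.left ≫ g.left := rfl

@[simp]
theorem comp_base {x y z : SplitCospanOver G p q} (f : x ⟶ y) (g : y ⟶ z) :
    (f ≫ g).base = f.base ≫ g.base := rfl

@[simp]
theorem comp_right {x y z : SplitCospanOver G p q} (f : x ⟶ y) (g : y ⟶ z) :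
    (f ≫ g).right = f.right ≫ g.right := rfl

/-- A commutative square on the cospan `(p, q)` with vertex in the family `G`, viewed as a
morphism from an identity cospan. -/
def ofSquare (p : D ⟶ E) (q : F ⟶ E) (t : T) (a : G t ⟶ D) (b : G t ⟶ F) (h : a ≫ p = b ≫ q) :
    SplitCospanOver G p q where
  left := t
  base := t
  right := t
  fst := 𝟙 _
  snd := 𝟙 _
  toLeft := a
  toBase := a ≫ p
  toRight := b
  w_left := by simp
  w_right := by simp [h]
  isSplitEpi := inferInstance

/-- A factorization of a square through a cospan over `(p, q)`, viewed as a morphism. -/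
def homOfSquare {t : T} {a : G t ⟶ D} {b : G t ⟶ F} (h : a ≫ p = b ≫ q)
    (y : SplitCospanOver G p q) (c₁ : G t ⟶ G y.left) (c₂ : G t ⟶ G y.right)
    (w : c₁ ≫ y.fst = c₂ ≫ y.snd) (h₁ : c₁ ≫ y.toLeft = a) (h₂ : c₂ ≫ y.toRight = b) :
    ofSquare p q t a b h ⟶ y where
  left := c₁
  base := c₁ ≫ y.fst
  right := c₂
  w_fst := Category.id_comp _
  w_snd := (Category.id_comp _).trans w
  w_left := h₁
  w_base := (Category.assoc _ _ _).trans
    ((by rw [← y.w_left, reassoc_of% h₁] : c₁ ≫ y.fst ≫ y.toBase = a ≫ p))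
  w_right := h₂

/-! ### `κ`-filteredness of the category of split cospans -/

section Filtered

variable {κ : Cardinal.{w}} [Fact κ.IsRegular]
  (hG : (ObjectProperty.ofObj G).IsCardinalFilteredGenerator κ)
  (hV : HasVeryWeakSplitPullbacks 𝒜) (hp : pureEpimorphisms 𝒜 κ p)

include hG hV hp

/-- The common step in bounding families and coequalizing morphisms: once the three components have
been handled separately, `G l`, `G b`, `G r` can be enlarged to a split cospan compatible with every
`x k`. -/
theorem exists_completion {ι : Type w} (hι : HasCardinalLT ι κ) (x : ι → SplitCospanOver G p q)
    {l b r : T} (l' : G l ⟶ D) (b' : G b ⟶ E) (r' : G r ⟶ F)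
    (f : ∀ k, G (x k).left ⟶ G l) (g : ∀ k, G (x k).base ⟶ G b) (h : ∀ k, G (x k).right ⟶ G r)
    (hf : ∀ k, f k ≫ l' = (x k).toLeft) (hg : ∀ k, g k ≫ b' = (x k).toBase)
    (hh : ∀ k, h k ≫ r' = (x k).toRight) :
    ∃ (y : SplitCospanOver G p q) (f₁ : G l ⟶ G y.left) (g₁ : G b ⟶ G y.base)
      (h₁ : G r ⟶ G y.right), f₁ ≫ y.toLeft = l' ∧ g₁ ≫ y.toBase = b' ∧ h₁ ≫ y.toRight = r' ∧
      (∀ k, (x k).fst ≫ g k ≫ g₁ = f k ≫ f₁ ≫ y.fst) ∧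
      (∀ k, (x k).snd ≫ g k ≫ g₁ = h k ≫ h₁ ≫ y.snd) := by
  have hpres (t : T) : IsCardinalPresentable (G t) κ :=
    hG.le_isCardinalPresentable _ (ObjectProperty.ofObj_apply G t)
  have hfin : HasCardinalLT (ULift.{w} (Fin 3)) κ :=
    hasCardinalLT_of_finite _ _ (Cardinal.IsRegular.aleph0_le Fact.out)
  obtain ⟨_, ⟨b₁⟩, e₁, t, ht⟩ := exists_common_factorization hG hfin (X := E)
    (S := fun k => G (![l, b, r] k.down)) (fun _ => hpres _)
    (fun k => match k with
      | ⟨0⟩ => l' ≫ p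
      | ⟨1⟩ => b'
      | ⟨2⟩ => r' ≫ q)
  let u₀ : G l ⟶ G b₁ := t ⟨0⟩
  let u₁ : G b ⟶ G b₁ := t ⟨1⟩
  let u₂ : G r ⟶ G b₁ := t ⟨2⟩
  have hu₀ : u₀ ≫ e₁ = l' ≫ p := ht ⟨0⟩
  have hu₁ : u₁ ≫ e₁ = b' := ht ⟨1⟩
  have hu₂ : u₂ ≫ e₁ = r' ≫ q := ht ⟨2⟩
  -- The squares on first legs commute only after mapping to `E`; enlarging the codomain makes them
  -- commute, and a second enlargement does the same for the second legs.
  obtain ⟨_, ⟨b₂⟩, e₂, v, hv, hv'⟩ := exists_common_coequalization hG hι (fun k => hpres (x k).left)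
    e₁ (fun k => (x k).fst ≫ g k ≫ u₁) (fun k => f k ≫ u₀)
    (fun k => by simp [hu₀, hu₁, hg, reassoc_of% (hf k), (x k).w_left])
  obtain ⟨_, ⟨b₃⟩, e₃, v₂, hv₂, hv₂'⟩ := exists_common_coequalization hG hι
    (fun k => hpres (x k).right) e₂ (fun k => (x k).snd ≫ g k ≫ u₁ ≫ v) (fun k => h k ≫ u₂ ≫ v)
    (fun k => by simp [hv, hu₁, hu₂, hg, reassoc_of% (hh k), (x k).w_right])
  -- Splitting comes last: it changes only the domain of the first leg, so the second leg and its
  -- squares survive.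
  obtain ⟨_, ⟨l₁⟩, a, p₁, d₁, hsplit, ha, had, hd⟩ := exists_isSplitEpi_over hG hV hp (hpres l)
    (hpres b₃) (u₀ ≫ v ≫ v₂) l' e₃ (by simp [hv₂, hv, hu₀])
  refine ⟨⟨l₁, b₃, r, p₁, u₂ ≫ v ≫ v₂, d₁, e₃, r', hd, by simp [hv₂, hv, hu₂], hsplit⟩,
    a, u₁ ≫ v ≫ v₂, 𝟙 _, had, by simp [hv₂, hv, hu₁], by simp, fun k => ?_, fun k => ?_⟩
  · have := hv' k
    simp only [Category.assoc] at this
    simp [ha, reassoc_of% this]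
  · have := hv₂' k
    simp only [Category.assoc] at this
    simp [this]

theorem exists_hom_of_family {ι : Type w} (x : ι → SplitCospanOver G p q)
    (hι : HasCardinalLT ι κ) : ∃ y : SplitCospanOver G p q, ∀ k, Nonempty (x k ⟶ y) := by
  have hpres (t : T) : IsCardinalPresentable (G t) κ :=
    hG.le_isCardinalPresentable _ (ObjectProperty.ofObj_apply G t)
  obtain ⟨_, ⟨l⟩, l', f, hf⟩ := exists_common_factorization hG hι
    (fun k => hpres (x k).left) (fun k => (x k).toLeft)
  obtain ⟨_, ⟨b⟩, b', g, hg⟩ := exists_common_factorization hG hι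
    (fun k => hpres (x k).base) (fun k => (x k).toBase)
  obtain ⟨_, ⟨r⟩, r', h, hh⟩ := exists_common_factorization hG hι
    (fun k => hpres (x k).right) (fun k => (x k).toRight)
  obtain ⟨y, f₁, g₁, h₁, hf₁, hg₁, hh₁, w₁, w₂⟩ :=
    exists_completion hG hV hp hι x l' b' r' f g h hf hg hh
  exact ⟨y, fun k => ⟨⟨f k ≫ f₁, g k ≫ g₁, h k ≫ h₁, by simp [w₁], by simp [w₂],
    by simp [hf₁, hf], by simp [hg₁, hg], by simp [hh₁, hh]⟩⟩⟩

/-- Coequalizing each component separately destroys the cospan structure of the target;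
`exists_completion`, applied to the one-element family `y`, restores it. -/
theorem exists_coequalizing_hom {ι : Type w} {x y : SplitCospanOver G p q} (φ : ι → (x ⟶ y))
    (hι : HasCardinalLT ι κ) :
    ∃ (z : SplitCospanOver G p q) (ψ : y ⟶ z), ∀ i j, φ i ≫ ψ = φ j ≫ ψ := by
  have hpres (t : T) : IsCardinalPresentable (G t) κ :=
    hG.le_isCardinalPresentable _ (ObjectProperty.ofObj_apply G t)
  have hι₂ : HasCardinalLT (ι × ι) κ :=
    hasCardinalLT_prod (Cardinal.IsRegular.aleph0_le Fact.out) hι hι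
  have hunit : HasCardinalLT PUnit.{w + 1} κ :=
    hasCardinalLT_of_finite _ _ (Cardinal.IsRegular.aleph0_le Fact.out)
  obtain ⟨_, ⟨l⟩, l', f, hf, hf'⟩ := exists_common_coequalization hG hι₂
    (fun _ => hpres x.left) y.toLeft (fun k => (φ k.1).left) (fun k => (φ k.2).left) (by simp)
  obtain ⟨_, ⟨b⟩, b', g, hg, hg'⟩ := exists_common_coequalization hG hι₂
    (fun _ => hpres x.base) y.toBase (fun k => (φ k.1).base) (fun k => (φ k.2).base) (by simp)
  obtain ⟨_, ⟨r⟩, r', h, hh, hh'⟩ := exists_common_coequalization hG hι₂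
    (fun _ => hpres x.right) y.toRight (fun k => (φ k.1).right) (fun k => (φ k.2).right) (by simp)
  obtain ⟨z, f₁, g₁, h₁, hf₁, hg₁, hh₁, w₁, w₂⟩ :=
    exists_completion hG hV hp hunit (fun _ => y) l' b' r' (fun _ => f) (fun _ => g) (fun _ => h)
      (fun _ => hf) (fun _ => hg) (fun _ => hh)
  refine ⟨z, ⟨f ≫ f₁, g ≫ g₁, h ≫ h₁, by simp [w₁ ⟨⟩], by simp [w₂ ⟨⟩],
    by simp [hf₁, hf], by simp [hg₁, hg], by simp [hh₁, hh]⟩, fun i j => ?_⟩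
  ext
  · simp [reassoc_of% (hf' (i, j))]
  · simp [reassoc_of% (hg' (i, j))]
  · simp [reassoc_of% (hh' (i, j))]

theorem isCardinalFiltered : IsCardinalFiltered (SplitCospanOver G p q) κ := by
  rw [isCardinalFiltered_iff]
  refine ⟨fun ι x hι => exists_hom_of_family hG hV hp x hι, fun ι x y φ hι => ?_⟩
  -- With no morphism from `x` to `y` given, a common target of both objects is still required.
  rcases isEmpty_or_nonempty ι with _ | ⟨⟨i₀⟩⟩
  · obtain ⟨z, hz⟩ := exists_hom_of_family hG hV hp (fun k : ULift.{w} Bool => cond k.down x y)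
      (hasCardinalLT_of_finite _ _ (Cardinal.IsRegular.aleph0_le Fact.out))
    exact ⟨z, (hz ⟨false⟩).some, (hz ⟨true⟩).some, isEmptyElim⟩
  · obtain ⟨z, ψ, h⟩ := exists_coequalizing_hom hG hV hp φ hι
    exact ⟨z, ψ, φ i₀ ≫ ψ, fun i => h i i₀⟩

end Filtered

/-! ### The colimit of the pullbacks of split cospans -/

section Pullback

variable [∀ x : SplitCospanOver G p q, HasPullback x.fst x.snd]

/-- The map on pullbacks induced by a morphism of cospans. -/
noncomputable def pullbackMap {x y : SplitCospanOver G p q} (φ : x ⟶ y) :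
    pullback x.fst x.snd ⟶ pullback y.fst y.snd :=
  pullback.map _ _ _ _ φ.left φ.right φ.base φ.w_fst φ.w_snd

@[simp]
theorem pullbackMap_fst {x y : SplitCospanOver G p q} (φ : x ⟶ y) :
    pullbackMap φ ≫ pullback.fst y.fst y.snd = pullback.fst x.fst x.snd ≫ φ.left :=
  pullback.lift_fst _ _ _

@[simp]
theorem pullbackMap_fst_assoc {x y : SplitCospanOver G p q} (φ : x ⟶ y) {Z : 𝒜}
    (h : G y.left ⟶ Z) :
    pullbackMap φ ≫ pullback.fst y.fst y.snd ≫ h = pullback.fst x.fst x.snd ≫ φ.left ≫ h := by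
  rw [← Category.assoc, pullbackMap_fst, Category.assoc]

@[simp]
theorem pullbackMap_snd {x y : SplitCospanOver G p q} (φ : x ⟶ y) :
    pullbackMap φ ≫ pullback.snd y.fst y.snd = pullback.snd x.fst x.snd ≫ φ.right :=
  pullback.lift_snd _ _ _

@[simp]
theorem pullbackMap_snd_assoc {x y : SplitCospanOver G p q} (φ : x ⟶ y) {Z : 𝒜}
    (h : G y.right ⟶ Z) :
    pullbackMap φ ≫ pullback.snd y.fst y.snd ≫ h = pullback.snd x.fst x.snd ≫ φ.right ≫ h := by
  rw [← Category.assoc, pullbackMap_snd, Category.assoc]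

variable (G p q) in
/-- The functor sending a cospan over `(p, q)` to its pullback. -/
noncomputable def pullbackFunctor : SplitCospanOver G p q ⥤ 𝒜 where
  obj x := pullback x.fst x.snd
  map φ := pullbackMap φ
  map_id x := by apply pullback.hom_ext <;> simp
  map_comp φ ψ := by apply pullback.hom_ext <;> simp

/-- The existence half of the universal property: the square is itself an identity cospan, and `G t`
maps to its pullback by the diagonal. -/
theorem exists_lift_of_square (t : T) (a : G t ⟶ D) (b : G t ⟶ F) (h : a ≫ p = b ≫ q) :
    ∃ (x : SplitCospanOver G p q) (c : G t ⟶ pullback x.fst x.snd),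
      c ≫ pullback.fst x.fst x.snd ≫ x.toLeft = a ∧
      c ≫ pullback.snd x.fst x.snd ≫ x.toRight = b :=
  ⟨ofSquare p q t a b h, pullback.lift (f := (ofSquare p q t a b h).fst)
    (g := (ofSquare p q t a b h).snd) (𝟙 _) (𝟙 _) rfl,
    (pullback.lift_fst_assoc _ _ _ _).trans (Category.id_comp _),
    (pullback.lift_snd_assoc _ _ _ _).trans (Category.id_comp _)⟩

/-- The colimit of the pullbacks of the split cospans over `(p, q)` is a pullback of `(p, q)`. -/
theorem hasPullback {κ : Cardinal.{w}} [Fact κ.IsRegular] [HasCardinalFilteredColimits 𝒜 κ]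
    (hG : (ObjectProperty.ofObj G).IsCardinalFilteredGenerator κ)
    (hV : HasVeryWeakSplitPullbacks 𝒜) (hp : pureEpimorphisms 𝒜 κ p) : HasPullback p q := by
  have := isCardinalFiltered (q := q) hG hV hp
  have := isFiltered_of_isCardinalFiltered (SplitCospanOver G p q) κ
  have := HasCardinalFilteredColimits.hasColimitsOfShape 𝒜 (κ := κ) (SplitCospanOver G p q)
  obtain ⟨W, ι, u, v, hu, hv, hι, hext, hfac⟩ :
      ∃ (W : 𝒜) (ι : ∀ x : SplitCospanOver G p q, pullback x.fst x.snd ⟶ W) (u : W ⟶ D)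
        (v : W ⟶ F), (∀ x, ι x ≫ u = pullback.fst _ _ ≫ x.toLeft) ∧
        (∀ x, ι x ≫ v = pullback.snd _ _ ≫ x.toRight) ∧
        (∀ ⦃x y⦄ (φ : x ⟶ y), pullbackMap φ ≫ ι y = ι x) ∧
        (∀ ⦃Z : 𝒜⦄ (a b : W ⟶ Z), (∀ x, ι x ≫ a = ι x ≫ b) → a = b) ∧
        (∀ ⦃S : 𝒜⦄, IsCardinalPresentable S κ → ∀ a : S ⟶ W, ∃ x, ∃ a', a' ≫ ι x = a) := by
    let c₁ : Cocone (pullbackFunctor G p q) :=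
      { pt := D
        ι :=
          { app := fun x => pullback.fst x.fst x.snd ≫ x.toLeft
            naturality := fun x y φ => (pullbackMap_fst_assoc φ _).trans
              ((by simp : pullback.fst x.fst x.snd ≫ φ.left ≫ y.toLeft =
                (pullback.fst x.fst x.snd ≫ x.toLeft) ≫ 𝟙 _)) } }
    let c₂ : Cocone (pullbackFunctor G p q) :=
      { pt := F
        ι :=
          { app := fun x => pullback.snd x.fst x.snd ≫ x.toRight
            naturality := fun x y φ => (pullbackMap_snd_assoc φ _).trans
              ((by simp : pullback.snd x.fst x.snd ≫ φ.right ≫ y.toRight =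
                (pullback.snd x.fst x.snd ≫ x.toRight) ≫ 𝟙 _)) } }
    exact ⟨colimit (pullbackFunctor G p q), colimit.ι (pullbackFunctor G p q), colimit.desc _ c₁,
      colimit.desc _ c₂, colimit.ι_desc c₁, colimit.ι_desc c₂,
      fun _ _ => colimit.w (pullbackFunctor G p q), fun _ _ _ => colimit.hom_ext,
      fun _ _ a => IsCardinalPresentable.exists_hom_of_isColimit κ
        (colimit.isColimit (pullbackFunctor G p q)) a⟩
  refine (isPullback_of_isCardinalFilteredGenerator hG (fst := u) (snd := v) ?_ ?_ ?_).hasPullback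
  · refine hext _ _ fun x => ?_
    rw [reassoc_of% (hu x), reassoc_of% (hv x), x.w_left, x.w_right, pullback.condition_assoc]
  · rintro _ ⟨t⟩ a b hab
    obtain ⟨x, c, rfl, rfl⟩ := exists_lift_of_square t a b hab
    exact ⟨c ≫ ι x, by simp [hu], by simp [hv]⟩
  · rintro _ ⟨t⟩ a b hab₁ hab₂
    have ht : IsCardinalPresentable (G t) κ :=
      hG.le_isCardinalPresentable _ (ObjectProperty.ofObj_apply G t)
    obtain ⟨m, a', b', rfl, rfl⟩ : ∃ m, ∃ a' b', a' ≫ ι m = a ∧ b' ≫ ι m = b := by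
      obtain ⟨i, a', rfl⟩ := hfac ht a
      obtain ⟨j, b', rfl⟩ := hfac ht b
      exact ⟨IsFiltered.max i j, a' ≫ pullbackMap (IsFiltered.leftToMax i j),
        b' ≫ pullbackMap (IsFiltered.rightToMax i j), by rw [Category.assoc, hι],
        by rw [Category.assoc, hι]⟩
    simp only [Category.assoc, hu, hv] at hab₁ hab₂
    have w : (a' ≫ pullback.fst _ _ ≫ m.toLeft) ≫ p = (a' ≫ pullback.snd _ _ ≫ m.toRight) ≫ q := by
      simp [m.w_left, m.w_right, pullback.condition_assoc]
    -- Since `a'` and `b'` induce the same square on `(p, q)`, `φ` and `ψ` are parallel morphisms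
    -- from one identity cospan to `m`.
    let φ := homOfSquare w m (a' ≫ pullback.fst _ _) (a' ≫ pullback.snd _ _)
      (by simp [pullback.condition]) (by simp) (by simp)
    let ψ := homOfSquare w m (b' ≫ pullback.fst _ _) (b' ≫ pullback.snd _ _)
      (by simp [pullback.condition]) (by simp [hab₁]) (by simp [hab₂])
    let χ := IsFiltered.coeqHom φ ψ
    have h₁ : (a' ≫ pullback.fst _ _) ≫ χ.left = (b' ≫ pullback.fst _ _) ≫ χ.left :=
      congr_arg Hom.left (IsFiltered.coeq_condition φ ψ)
    have h₂ : (a' ≫ pullback.snd _ _) ≫ χ.right = (b' ≫ pullback.snd _ _) ≫ χ.right :=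
      congr_arg Hom.right (IsFiltered.coeq_condition φ ψ)
    have h : a' ≫ pullbackMap χ = b' ≫ pullbackMap χ := by
      apply pullback.hom_ext
      · simpa using h₁
      · simpa using h₂
    rw [← hι χ, reassoc_of% h]

end Pullback

end SplitCospanOver

end SplitCospan

/-! ### Passage from presentable objects to the whole category -/

/-- Pullbacks of split epimorphisms in the full subcategory of `κ`-presentable objects are
pullbacks in the whole category. -/
theorem hasPullback_of_hasPullbacks_splitEpimorphisms {𝒜 : Type u} [Category.{v} 𝒜]
    {κ : Cardinal.{w}} [Fact κ.IsRegular] [IsCardinalAccessibleCategory 𝒜 κ]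
    (h : (splitEpimorphisms (isCardinalPresentable 𝒜 κ).FullSubcategory).HasPullbacks)
    {D E F : 𝒜} (hD : IsCardinalPresentable D κ) (hE : IsCardinalPresentable E κ)
    (hF : IsCardinalPresentable F κ) (p : D ⟶ E) (q : F ⟶ E) [IsSplitEpi p] :
    HasPullback p q := by
  let D' : (isCardinalPresentable 𝒜 κ).FullSubcategory := ⟨D, hD⟩
  let E' : (isCardinalPresentable 𝒜 κ).FullSubcategory := ⟨E, hE⟩
  let F' : (isCardinalPresentable 𝒜 κ).FullSubcategory := ⟨F, hF⟩
  let p' : D' ⟶ E' := ObjectProperty.homMk p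
  let q' : F' ⟶ E' := ObjectProperty.homMk q
  have hp' : IsSplitEpi p' := ⟨⟨⟨ObjectProperty.homMk (section_ p), by ext; simp [p', D', E']⟩⟩⟩
  have : HasPullback p' q' := h.hasPullback q' hp'
  have sq := IsPullback.of_hasPullback p' q'
  -- The `κ`-presentable objects form a generator, so the universal property inside the full
  -- subcategory already covers all the test objects needed.
  refine (isPullback_of_isCardinalFilteredGenerator
    (isCardinalFilteredGenerator_isCardinalPresentable 𝒜 κ)
    (fst := (pullback.fst p' q').hom) (snd := (pullback.snd p' q').hom)
    (f := p) (g := q) ?_ ?_ ?_).hasPullback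
  · exact congr_arg InducedCategory.Hom.hom sq.w
  · intro S hS a b hab
    let S' : (isCardinalPresentable 𝒜 κ).FullSubcategory := ⟨S, hS⟩
    let a' : S' ⟶ D' := ObjectProperty.homMk a
    let b' : S' ⟶ F' := ObjectProperty.homMk b
    have w : a' ≫ p' = b' ≫ q' := by ext; exact hab
    exact ⟨(sq.lift a' b' w).hom, congr_arg InducedCategory.Hom.hom (sq.lift_fst a' b' w),
      congr_arg InducedCategory.Hom.hom (sq.lift_snd a' b' w)⟩
  · intro S hS a b h₁ h₂
    let S' : (isCardinalPresentable 𝒜 κ).FullSubcategory := ⟨S, hS⟩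
    let a' : S' ⟶ pullback p' q' := ObjectProperty.homMk a
    let b' : S' ⟶ pullback p' q' := ObjectProperty.homMk b
    have : a' = b' := sq.hom_ext (by ext; exact h₁) (by ext; exact h₂)
    exact congr_arg InducedCategory.Hom.hom this

theorem corollary15p2 (𝒜 : Type u) [Category.{w} 𝒜] (κ : Cardinal.{w}) [Fact κ.IsRegular]
    [IsCardinalAccessibleCategory 𝒜 κ] :
    (HasFiniteCoproducts 𝒜 → HasVeryWeakSplitPullbacks 𝒜) ∧
    (HasVeryWeakSplitPullbacks 𝒜 →
      -- pullbacks of split epimorphisms exist in the category of `κ`-presentable objects, or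
      -- split epimorphisms of `κ`-presentable objects have pullbacks, formed in the whole
      -- category, along morphisms of `κ`-presentable objects
      ((splitEpimorphisms (isCardinalPresentable 𝒜 κ).FullSubcategory).HasPullbacks ∨
        (∀ ⦃D E F : 𝒜⦄ (p : D ⟶ E) (q : F ⟶ E),
          IsCardinalPresentable D κ → IsCardinalPresentable E κ → IsCardinalPresentable F κ →
          IsSplitEpi p → HasPullback p q)) →
      (∀ ⦃D E F : 𝒜⦄ (p : D ⟶ E) (q : F ⟶ E), pureEpimorphisms 𝒜 κ p → HasPullback p q) ∧
      (∀ ⦃P D E F : 𝒜⦄ (p : D ⟶ E) (q : F ⟶ E) (p' : P ⟶ F) (q' : P ⟶ D),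
        pureEpimorphisms 𝒜 κ p → IsPullback q' p' p q → pureEpimorphisms 𝒜 κ p')) := by
  refine ⟨fun _ => hasVeryWeakSplitPullbacks_of_hasFiniteCoproducts, fun hV hpb =>
    ⟨fun D E F p q hp => ?_, fun P D E F p q p' q' => pureEpimorphisms_of_isPullback⟩⟩
  replace hpb : ∀ ⦃D E F : 𝒜⦄ (p : D ⟶ E) (q : F ⟶ E), IsCardinalPresentable D κ →
      IsCardinalPresentable E κ → IsCardinalPresentable F κ → IsSplitEpi p → HasPullback p q := by
    rcases hpb with hpb | hpb
    · intro D E F p q hD hE hF hp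
      exact hasPullback_of_hasPullbacks_splitEpimorphisms hpb hD hE hF p q
    · exact hpb
  obtain ⟨P, _, hP⟩ := HasCardinalFilteredGenerator.exists_small_generator 𝒜 κ
  -- Indexing the generator by a type in `Type w` makes the category of split cospans `w`-small, so
  -- that its colimits exist in `𝒜`.
  let G : Shrink.{w} (Subtype P) → 𝒜 := fun t => ((equivShrink (Subtype P)).symm t).1
  have hG : (ObjectProperty.ofObj G).IsCardinalFilteredGenerator κ := by
    have : ObjectProperty.ofObj G = P := by
      ext X
      refine ⟨?_, fun hX => ?_⟩
      · rintro ⟨t⟩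
        exact ((equivShrink (Subtype P)).symm t).2
      · have : G (equivShrink _ ⟨X, hX⟩) = X := by simp [G]
        rw [← this]
        exact ObjectProperty.ofObj_apply G _
    rwa [this]
  have hpres (t) : IsCardinalPresentable (G t) κ :=
    hG.le_isCardinalPresentable _ (ObjectProperty.ofObj_apply G t)
  have (x : SplitCospanOver G p q) : HasPullback x.fst x.snd :=
    hpb _ _ (hpres _) (hpres _) (hpres _) x.isSplitEpi
  exact SplitCospanOver.hasPullback hG hV hp
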